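/- Fix a dimension $d \ge 1$ and radii $0 < r_n < 1/4$, and let $\mu_n = n \phi_d r_n^d$, where $\phi_d$ is the volume of the Euclidean unit ball of $\mathbb R^d$. The hard random geometric graph $G(n,r_n)$ has vertex set $V = \{1,\dots,N_n\}$ with $N_n$ Poisson of mean $n$; its vertices have independent positions, uniform on $[0,1]^d$ and independent of $N_n$, and two vertices are adjacent when their distance on the torus is at most $r_n$. Let $k_n \ge 2$ be integers with $\mathbb P(N_n \ge k_n) \to 1$. The graph $G_{k_n}(n,r_n)$ arises from $G(n,r_n)$ by choosing a set $K_n$ of $k_n$ vertices uniformly at random, independently of the positions, and adding all missing edges inside $K_n$. The vertex-degree (VD) algorithm outputs $k_n$ vertices of largest degree in $G_{k_n}(n,r_n)$. It is said to recover the planted clique with high probability if the probability that its output, however ties are broken, is exactly $K_n$ tends to $1$ as $n \to \infty$. Let $H(x) = 1 - x + x\log x$, with $H(0)=1$, let $H_+^{-1}$ be the inverse of $H$ on $[1,\infty)$ and $H_-^{-1}$ the inverse of $H$ on $[0,1]$; equivalently, $H_+^{-1}(y) = \exp\{W_0((y-1)/e)+1\}$ for $y \ge 0$, and $H_-^{-1}(y)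 = \exp\{W_{-1}((y-1)/e)+1\}$ for $0 \le y < 1$, $H_-^{-1}(1) = 0$, with the two real branches $W_0, W_{-1}$ of the Lambert function. Assume that $\mu_n/\log n \to \alpha \in [0,\infty]$. If $\alpha<\infty$, put $$T(n) = \begin{cases} \dfrac{\log n}{\log(\log (n)/\mu_n)} & \text{if } \alpha = 0,\\ \mu_n H_+^{-1}(\alpha^{-1}) & \text{if } \alpha \in (0,\infty),\end{cases} \qquad t(n) = \begin{cases} 0 & \text{if } \alpha \in [0,1),\\ \mu_n H_-^{-1}(\alpha^{-1}) & \text{if } \alpha \in [1,\infty).\end{cases}$$ Let $\varepsilon > 0$. 1. If $\alpha \in [0,\infty)$ and $k_n > (1+\varepsilon)(T(n)-t(n))$ for all large $n$, then the VD-algorithm recovers the planted clique with high probability; in the case $\alpha = 0$ it is assumed in addition that $k_n \to \infty$ or that even $k_n - 1 > (1+\varepsilon)(T(n)-t(n))$ for all large $n$. 2. If $\alpha = \infty$ and $k_n > \varepsilon\mu_n$ for all large $n$, then the VD-algorithm recovers the planted clique with high probability. -/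

import Mathlib

open Filter Topology MeasureTheory
open scoped ENNReal NNReal

noncomputable section

namespace PlantedRGG

/-! ### The planted hard random geometric graph on the torus -/

/-- The toroidal (Euclidean) distance between two points of the unit cube `[0,1]^d`. -/
def torusDist {d : ℕ} (x y : Fin d → ℝ) : ℝ :=
  Real.sqrt (∑ i, (min |x i - y i| (1 - |x i - y i|)) ^ 2)

/-- The hard geometric graph on the points `x 0, …, x (m-1)` of the torus: two distinct vertices
are adjacent when their toroidal distance is at most `r`. -/
def geomGraph {d m : ℕ} (r : ℝ) (x : Fin m → Fin d → ℝ) : SimpleGraph (Fin m) where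
  Adj i j := i ≠ j ∧ torusDist (x i) (x j) ≤ r
  symm := ⟨fun i j h => ⟨h.1.symm, by
    have e : torusDist (x j) (x i) = torusDist (x i) (x j) := by
      simp only [torusDist, abs_sub_comm]
    exact e.trans_le h.2⟩⟩
  loopless := ⟨fun _ h => h.1 rfl⟩

/-- The graph obtained from `G` by adding all missing edges between vertices of `K`. -/
def plantClique {V : Type*} (G : SimpleGraph V) (K : Finset V) : SimpleGraph V where
  Adj i j := G.Adj i j ∨ (i ≠ j ∧ i ∈ K ∧ j ∈ K)
  symm := ⟨fun _ _ h => h.imp (fun a => a.symm) (fun a => ⟨a.1.symm, a.2.2, a.2.1⟩)⟩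
  loopless := ⟨fun _ h => h.elim (fun a => G.irrefl a) (fun a => a.1 rfl)⟩

/-- The volume `φ_d` of the Euclidean unit ball of dimension `d`. -/
def ballVolume (d : ℕ) : ℝ :=
  (volume (Metric.ball (0 : EuclideanSpace ℝ (Fin d)) 1)).toReal

/-- The expected degree `μ_n = n φ_d r_n ^ d`. -/
def meanDegree (d : ℕ) (r : ℕ → ℝ) (n : ℕ) : ℝ :=
  n * ballVolume d * r n ^ d

/-- The law of `m` independent uniformly distributed points of `[0,1]^d`. -/
def positionLaw (d m : ℕ) : Measure (Fin m → Fin d → ℝ) :=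
  Measure.pi fun _ => volume.restrict (Set.Icc 0 1)

/-- The outcomes of the model: a number `m` of vertices, the positions of the `m` vertices, and
a set of vertices. -/
abbrev Outcome (d : ℕ) : Type := Σ m : ℕ, (Fin m → Fin d → ℝ) × Finset (Fin m)

/-- The joint law of the number `N` of vertices, the positions and the planted set `K`: `N` is
Poisson with mean `n`; given `N = m`, the positions are independent and uniform on `[0,1]^d` and,
independently of them, `K` is uniform among the sets of `k` vertices.
There is no such set when `m < k`, and such `m` contribute nothing, so that the total mass is
the probability that `N ≥ k`. -/
def plantedLaw (d n k : ℕ) : Measure (Outcome d) :=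
  Measure.sum fun m : ℕ =>
    ProbabilityTheory.poissonMeasure (n : ℝ≥0) {m} •
      ((positionLaw d m).prod
        (ProbabilityTheory.uniformOn
          (↑(Finset.powersetCard k (Finset.univ : Finset (Fin m))) : Set (Finset (Fin m))))).map
        (Sigma.mk m)

/-! ### The vertex-degree algorithm -/

/-- The number of neighbours of a vertex. -/
def deg {m : ℕ} (G : SimpleGraph (Fin m)) (i : Fin m) : ℕ := (G.neighborSet i).ncard

/-- `S` is a possible output of the vertex-degree algorithm on the input `(G, k)`: it consists of
`k` vertices with the largest degrees (ties may be broken in any way). -/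
def IsVDOutput {m : ℕ} (G : SimpleGraph (Fin m)) (k : ℕ) (S : Finset (Fin m)) : Prop :=
  S.card = k ∧ ∀ i ∈ S, ∀ j ∉ S, deg G j ≤ deg G i

/-- The event that the vertex-degree algorithm, run on the geometric graph of radius `r` with the
planted clique, outputs the planted clique, however ties are broken. -/
def recoveryEvent (d : ℕ) (r : ℝ) (k : ℕ) : Set (Outcome d) :=
  {ω | ∀ S : Finset (Fin ω.1),
    IsVDOutput (plantClique (geomGraph r ω.2.1) ω.2.2) k S ↔ S = ω.2.2}

/-- Exact recovery with high probability by the vertex-degree algorithm. -/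
def VDRecovers (d : ℕ) (r : ℕ → ℝ) (k : ℕ → ℕ) : Prop :=
  Tendsto (fun n => plantedLaw d n (k n) (recoveryEvent d (r n) (k n))) atTop (𝓝 1)

/-- With high probability there are at least `k_n` vertices, so that a clique of size `k_n` can
be planted. -/
def Plantable (k : ℕ → ℕ) : Prop :=
  Tendsto (fun n : ℕ => ProbabilityTheory.poissonMeasure (n : ℝ≥0) {m | k n ≤ m}) atTop (𝓝 1)

/-! ### The asymptotic maximum and minimum degrees -/

/-- The function `H(x) = 1 - x + x log x`. -/
def entropyH (x : ℝ) : ℝ := 1 - x + x * Real.log x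

/-- The inverse of `H` on `[1,∞)`, defined for `y ≥ 0`. -/
def HinvPlus (y : ℝ) : ℝ := Function.invFunOn entropyH (Set.Ici 1) y

/-- The inverse of `H` on `[0,1]`, defined for `0 ≤ y ≤ 1`. -/
def HinvMinus (y : ℝ) : ℝ := Function.invFunOn entropyH (Set.Icc 0 1) y

/-- The asymptotic maximum degree `T(n)`, as a function of `α < ∞`, `μ_n` and `n`. -/
def maxDegAsymp (α μ : ℝ) (n : ℕ) : ℝ :=
  if α = 0 then Real.log n / Real.log (Real.log n / μ) else μ * HinvPlus α⁻¹

/-- The asymptotic minimum degree `t(n)`, as a function of `α < ∞` and `μ_n`. -/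
def minDegAsymp (α μ : ℝ) : ℝ :=
  if α < 1 then 0 else μ * HinvMinus α⁻¹

/-! The two branches of the Lambert function, and the resulting formulas for the inverses of
`H`. -/

/-- The branch `W₀`, defined for `z ≥ -1/e`. -/
def lambertW0 (z : ℝ) : ℝ := Function.invFunOn (fun w => w * Real.exp w) (Set.Ici (-1)) z

/-- The branch `W₋₁`, defined for `-1/e ≤ z < 0`. -/
def lambertWm1 (z : ℝ) : ℝ := Function.invFunOn (fun w => w * Real.exp w) (Set.Iic (-1)) z

theorem entropyH_exp (w : ℝ) :
    entropyH (Real.exp (w + 1)) = 1 + Real.exp 1 * (w * Real.exp w) := by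
  rw [entropyH, Real.log_exp, Real.exp_add]
  ring

theorem entropyH_eq : entropyH = InformationTheory.klFun := by
  funext x
  simp only [entropyH, InformationTheory.klFun]
  ring

theorem strictMonoOn_entropyH : StrictMonoOn entropyH (Set.Ici 1) := by
  rw [entropyH_eq]
  refine strictMonoOn_of_deriv_pos (convex_Ici 1)
    InformationTheory.continuous_klFun.continuousOn fun x hx => ?_
  rw [interior_Ici] at hx
  rw [InformationTheory.deriv_klFun]
  exact Real.log_pos hx

theorem strictAntiOn_entropyH : StrictAntiOn entropyH (Set.Icc 0 1) := by
  rw [entropyH_eq]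
  refine strictAntiOn_of_deriv_neg (convex_Icc 0 1)
    InformationTheory.continuous_klFun.continuousOn fun x hx => ?_
  rw [interior_Icc] at hx
  rw [InformationTheory.deriv_klFun]
  exact Real.log_neg hx.1 hx.2

theorem HinvPlus_spec {y : ℝ} (hy : 0 ≤ y) : 1 ≤ HinvPlus y ∧ entropyH (HinvPlus y) = y := by
  have h : ∃ a ∈ Set.Ici (1 : ℝ), entropyH a = y := by
    rw [entropyH_eq]
    have hc : Set.Ici (InformationTheory.klFun 1) ⊆ InformationTheory.klFun '' Set.Ici 1 :=
      isPreconnected_Ici.intermediate_value_Ici Set.self_mem_Ici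
        (le_principal_iff.2 (Ici_mem_atTop 1))
        InformationTheory.continuous_klFun.continuousOn InformationTheory.tendsto_klFun_atTop
    rw [InformationTheory.klFun_one] at hc
    exact hc hy
  exact ⟨Function.invFunOn_mem h, Function.invFunOn_eq h⟩

theorem HinvMinus_spec {y : ℝ} (hy : 0 ≤ y) (hy1 : y ≤ 1) :
    HinvMinus y ∈ Set.Icc (0 : ℝ) 1 ∧ entropyH (HinvMinus y) = y := by
  have h : ∃ a ∈ Set.Icc (0 : ℝ) 1, entropyH a = y := by
    rw [entropyH_eq]
    have hc := intermediate_value_Icc' (zero_le_one (α := ℝ))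
      (InformationTheory.continuous_klFun.continuousOn (s := Set.Icc 0 1))
    rw [InformationTheory.klFun_one, InformationTheory.klFun_zero] at hc
    exact hc ⟨hy, hy1⟩
  exact ⟨Function.invFunOn_mem h, Function.invFunOn_eq h⟩

theorem HinvPlus_eq_lambert {y : ℝ} (hy : 0 ≤ y) :
    HinvPlus y = Real.exp (lambertW0 ((y - 1) / Real.exp 1) + 1) := by
  obtain ⟨h1, h2⟩ := HinvPlus_spec hy
  have hpos : 0 < HinvPlus y := by linarith
  have key : ∀ w : ℝ, w * Real.exp w = (y - 1) / Real.exp 1 →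
      entropyH (Real.exp (w + 1)) = y := fun w hw => by
    rw [entropyH_exp, hw, mul_div_cancel₀ _ (Real.exp_pos 1).ne']; ring
  have h : ∃ a ∈ Set.Ici (-1 : ℝ), (fun w => w * Real.exp w) a = (y - 1) / Real.exp 1 := by
    refine ⟨Real.log (HinvPlus y) - 1, ?_, ?_⟩
    · have := Real.log_nonneg h1
      simp only [Set.mem_Ici]; linarith
    · have e := entropyH_exp (Real.log (HinvPlus y) - 1)
      rw [sub_add_cancel, Real.exp_log hpos, h2] at e
      rw [eq_div_iff (Real.exp_pos 1).ne']
      simp only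
      linarith
  have hm : lambertW0 ((y - 1) / Real.exp 1) ∈ Set.Ici (-1 : ℝ) := Function.invFunOn_mem h
  have he := key (lambertW0 ((y - 1) / Real.exp 1)) (Function.invFunOn_eq h)
  refine strictMonoOn_entropyH.injOn h1 ?_ (h2.trans he.symm)
  simp only [Set.mem_Ici] at hm ⊢
  exact Real.one_le_exp (by linarith)

theorem HinvMinus_eq_lambert {y : ℝ} (hy : 0 ≤ y) (hy1 : y < 1) :
    HinvMinus y = Real.exp (lambertWm1 ((y - 1) / Real.exp 1) + 1) := by
  obtain ⟨h1, h2⟩ := HinvMinus_spec hy hy1.le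
  have hpos : 0 < HinvMinus y := by
    rcases h1.1.lt_or_eq with h | h
    · exact h
    · rw [← h] at h2
      simp only [entropyH, zero_mul, sub_zero, add_zero] at h2
      exact absurd h2 (by linarith)
  have key : ∀ w : ℝ, w * Real.exp w = (y - 1) / Real.exp 1 →
      entropyH (Real.exp (w + 1)) = y := fun w hw => by
    rw [entropyH_exp, hw, mul_div_cancel₀ _ (Real.exp_pos 1).ne']; ring
  have h : ∃ a ∈ Set.Iic (-1 : ℝ), (fun w => w * Real.exp w) a = (y - 1) / Real.exp 1 := by
    refine ⟨Real.log (HinvMinus y) - 1, ?_, ?_⟩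
    · have := Real.log_nonpos hpos.le h1.2
      simp only [Set.mem_Iic]; linarith
    · have e := entropyH_exp (Real.log (HinvMinus y) - 1)
      rw [sub_add_cancel, Real.exp_log hpos, h2] at e
      rw [eq_div_iff (Real.exp_pos 1).ne']
      simp only
      linarith
  have hm : lambertWm1 ((y - 1) / Real.exp 1) ∈ Set.Iic (-1 : ℝ) := Function.invFunOn_mem h
  have he := key (lambertWm1 ((y - 1) / Real.exp 1)) (Function.invFunOn_eq h)
  refine strictAntiOn_entropyH.injOn h1 ?_ (h2.trans he.symm)
  simp only [Set.mem_Iic] at hm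
  exact ⟨(Real.exp_pos _).le, Real.exp_le_one_iff.2 (by linarith)⟩

theorem HinvMinus_one : HinvMinus 1 = 0 := by
  obtain ⟨h1, h2⟩ := HinvMinus_spec zero_le_one le_rfl
  refine strictAntiOn_entropyH.injOn h1 ⟨le_rfl, zero_le_one⟩ (h2.trans ?_)
  simp [entropyH]

end PlantedRGG

end

/- Recovery can fail only if some vertex has degree at least `s` before planting, or some clique
vertex has fewer than `s - (k - 1)` neighbours outside the clique. By translation invariance of the
torus, given the position of a vertex its adjacencies to the others are independent, so both events
are controlled by Chernoff bounds given the number of vertices, and averaging over the Poisson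
number of vertices turns powers into exponentials. With `s = A μ`, the two bounds are
`n exp (-μ H(A))` and `k exp (-μ H(a))` up to lower-order terms, so `s` can be placed just above `T`
as soon as `k` exceeds `T - t` by a constant factor. When `μ ≫ log n`, a deviation `δ μ` suffices,
because the planted clique adds `(1 - p) k` to the expected degrees of its vertices, where `p` is
the probability of an edge, and `p` stays away from `1`. -/

namespace PlantedRGG

/-! ### Volumes on the torus -/

theorem norm_unitAddCircle_coe {a : ℝ} (ha : |a| ≤ 1) :
    ‖(a : UnitAddCircle)‖ = min |a| (1 - |a|) := by
  have norm_abs : ‖(a : UnitAddCircle)‖ = ‖((|a| : ℝ) : UnitAddCircle)‖ := by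
    rcases abs_choice a with h | h <;> simp [h]
  rw [norm_abs, UnitAddCircle.norm_eq, abs_sub_round_eq_min]
  rcases ha.lt_or_eq with h | h
  · rw [Int.fract_eq_self.2 ⟨abs_nonneg a, h⟩]
  · simp [h]

theorem torusDist_eq_norm {d : ℕ} {x y : Fin d → ℝ} (hx : x ∈ Set.Icc 0 1)
    (hy : y ∈ Set.Icc 0 1) :
    torusDist x y = ‖WithLp.toLp 2 fun i => (y i : UnitAddCircle) - (x i : UnitAddCircle)‖ := by
  rw [torusDist, PiLp.norm_eq_of_L2]
  refine congrArg Real.sqrt (Finset.sum_congr rfl fun i _ => ?_)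
  have h : |x i - y i| ≤ 1 :=
    Real.dist_le_of_mem_Icc_01 ⟨hx.1 i, hx.2 i⟩ ⟨hy.1 i, hy.2 i⟩
  rw [norm_sub_rev, ← AddCircle.coe_sub, norm_unitAddCircle_coe h]

theorem measurePreserving_pi_coe (d : ℕ) (a : ℝ) :
    MeasurePreserving (fun (x : Fin d → ℝ) i => (x i : UnitAddCircle))
      (volume.restrict (Set.univ.pi fun _ => Set.Ioc a (a + 1))) volume := by
  rw [volume_pi, Measure.restrict_pi_pi]
  exact measurePreserving_pi _ _ fun _ => UnitAddCircle.measurePreserving_mk a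

theorem restrict_volume_Icc_zero_one (d : ℕ) :
    (volume : Measure (Fin d → ℝ)).restrict (Set.Icc 0 1) =
      volume.restrict (Set.univ.pi fun _ => Set.Ioc (0 : ℝ) (0 + 1)) := by
  rw [zero_add]
  exact (Measure.restrict_congr_set (Measure.univ_pi_Ioc_ae_eq_Icc (f := 0) (g := 1))).symm

theorem norm_toLp_unitAddCircle_coe {d : ℕ} {x : EuclideanSpace ℝ (Fin d)}
    (hx : ∀ i, |x i| ≤ 1 / 2) : ‖WithLp.toLp 2 fun i => (x i : UnitAddCircle)‖ = ‖x‖ := by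
  rw [PiLp.norm_eq_of_L2, EuclideanSpace.norm_eq]
  refine congrArg Real.sqrt (Finset.sum_congr rfl fun i _ => ?_)
  exact congrArg (· ^ 2) ((AddCircle.norm_coe_eq_abs_iff 1 one_ne_zero).2 (by simpa using hx i))

theorem closedBall_eq_preimage_torus {d : ℕ} {r : ℝ} (hr : r < 1 / 2) :
    Metric.closedBall (0 : EuclideanSpace ℝ (Fin d)) r = WithLp.ofLp ⁻¹'
      ((fun (x : Fin d → ℝ) i => (x i : UnitAddCircle)) ⁻¹' {c | ‖WithLp.toLp 2 c‖ ≤ r} ∩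
        Set.univ.pi fun _ => Set.Ioc (-(1 / 2)) (-(1 / 2) + 1)) := by
  ext x
  simp only [mem_closedBall_zero_iff, Set.mem_preimage, Set.mem_inter_iff, Set.mem_ofPred_eq,
    Set.mem_univ_pi, Set.mem_Ioc]
  constructor
  · intro h
    have hx : ∀ i, |x i| ≤ r := fun i => (PiLp.norm_apply_le x i).trans h
    refine ⟨(norm_toLp_unitAddCircle_coe fun i => (hx i).trans hr.le).trans_le h, fun i => ?_⟩
    constructor <;> linarith [abs_le.1 (hx i)]
  · rintro ⟨h, hx⟩
    rwa [norm_toLp_unitAddCircle_coe fun i => abs_le.2 ⟨(hx i).1.le, by linarith [(hx i).2]⟩] at h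

theorem measurableSet_norm_toLp_le (d : ℕ) (r : ℝ) :
    MeasurableSet {c : Fin d → UnitAddCircle | ‖WithLp.toLp 2 c‖ ≤ r} :=
  measurableSet_le (PiLp.continuous_toLp 2 _).norm.measurable measurable_const

/-- The probability that two given vertices of the random geometric graph of radius `r` are
adjacent, so that the expected degree `μ_n` is `n * edgeProb d (r n)`. -/
noncomputable def edgeProb (d : ℕ) (r : ℝ) : ℝ := ballVolume d * r ^ d

theorem volume_norm_toLp_le (d : ℕ) {r : ℝ} (hr : 0 ≤ r) (hr2 : r < 1 / 2) :
    volume {c : Fin d → UnitAddCircle | ‖WithLp.toLp 2 c‖ ≤ r} =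
      ENNReal.ofReal (edgeProb d r) := by
  have hm := measurableSet_norm_toLp_le d r
  have hcoe := measurePreserving_pi_coe d (-(1 / 2))
  rw [← hcoe.measure_preimage hm.nullMeasurableSet, Measure.restrict_apply (hcoe.measurable hm),
    ← (PiLp.volume_preserving_ofLp (Fin d)).measure_preimage ((hcoe.measurable hm).inter
      (.univ_pi fun _ => measurableSet_Ioc)).nullMeasurableSet,
    ← closedBall_eq_preimage_torus hr2, Measure.addHaar_closedBall _ _ hr, edgeProb, ballVolume,
    mul_comm, ENNReal.ofReal_mul ENNReal.toReal_nonneg,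
    ENNReal.ofReal_toReal measure_ball_lt_top.ne, finrank_euclideanSpace_fin]

theorem volume_torusDist_le {d : ℕ} {x : Fin d → ℝ} (hx : x ∈ Set.Icc 0 1) {r : ℝ} (hr : 0 ≤ r)
    (hr2 : r < 1 / 2) :
    volume.restrict (Set.Icc 0 1) {y | torusDist x y ≤ r} = ENNReal.ofReal (edgeProb d r) := by
  have hsub := (measurePreserving_sub_right (volume : Measure (Fin d → UnitAddCircle))
    fun i => (x i : UnitAddCircle)).comp (measurePreserving_pi_coe d 0)
  rw [← volume_norm_toLp_le d hr hr2,
    ← hsub.measure_preimage (measurableSet_norm_toLp_le d r).nullMeasurableSet,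
    ← restrict_volume_Icc_zero_one]
  refine measure_congr ?_
  filter_upwards [ae_restrict_mem measurableSet_Icc] with y hy
  exact congrArg (· ≤ r) (torusDist_eq_norm hx hy)

theorem ballVolume_pos (d : ℕ) : 0 < ballVolume d :=
  ENNReal.toReal_pos (Metric.measure_ball_pos _ _ one_pos).ne' measure_ball_lt_top.ne

theorem ballVolume_le_two_pow (d : ℕ) : ballVolume d ≤ 2 ^ d := by
  have hsub : Metric.ball (0 : EuclideanSpace ℝ (Fin d)) 1 ⊆ WithLp.ofLp ⁻¹' Metric.ball 0 1 := by
    intro x hx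
    rw [mem_ball_zero_iff] at hx
    rw [Set.mem_preimage, mem_ball_zero_iff, pi_norm_lt_iff one_pos]
    exact fun i => (PiLp.norm_apply_le x i).trans_lt hx
  refine ENNReal.toReal_le_of_le_ofReal (by positivity) ?_
  calc volume (Metric.ball (0 : EuclideanSpace ℝ (Fin d)) 1)
      ≤ volume (WithLp.ofLp ⁻¹' Metric.ball 0 1) := measure_mono hsub
    _ = volume (Metric.ball (0 : Fin d → ℝ) 1) :=
      (PiLp.volume_preserving_ofLp (Fin d)).measure_preimage measurableSet_ball.nullMeasurableSet
    _ = ENNReal.ofReal (2 ^ d) := by rw [Real.volume_pi_ball _ one_pos, mul_one, Fintype.card_fin]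

theorem edgeProb_nonneg (d : ℕ) {r : ℝ} (hr : 0 ≤ r) : 0 ≤ edgeProb d r :=
  mul_nonneg (ballVolume_pos d).le (pow_nonneg hr d)

theorem edgeProb_pos (d : ℕ) {r : ℝ} (hr : 0 < r) : 0 < edgeProb d r :=
  mul_pos (ballVolume_pos d) (pow_pos hr d)

theorem edgeProb_le_pow (d : ℕ) {r : ℝ} (hr : 0 ≤ r) : edgeProb d r ≤ (2 * r) ^ d := by
  rw [edgeProb, mul_pow]
  exact mul_le_mul_of_nonneg_right (ballVolume_le_two_pow d) (pow_nonneg hr d)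

/-! ### Chernoff bounds for numbers of neighbours -/

section Chernoff

theorem edgeProb_le_one (d : ℕ) {r : ℝ} (hr : 0 ≤ r) (hr2 : r ≤ 1 / 2) : edgeProb d r ≤ 1 :=
  (edgeProb_le_pow d hr).trans (pow_le_one₀ (by positivity) (by linarith))

section Resampling

variable {ι E : Type*} [Fintype ι] [MeasurableSpace E] (ν : Measure E)
  [IsProbabilityMeasure ν]

theorem lintegral_pi_eq_lintegral_update [DecidableEq ι] {g : (ι → E) → ℝ≥0∞}
    (hg : Measurable g) (j : ι) :
    ∫⁻ x, g x ∂Measure.pi (fun _ => ν) =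
      ∫⁻ x, ∫⁻ y, g (Function.update x j y) ∂ν ∂Measure.pi fun _ => ν := by
  have x₀ : ι → E := fun _ => (nonempty_of_isProbabilityMeasure ν).some
  have hg' : Measurable fun x => ∫⁻ y, g (Function.update x j y) ∂ν :=
    (hg.comp measurable_update').lintegral_prod_right'
  rw [lintegral_eq_lmarginal_univ x₀, lintegral_eq_lmarginal_univ x₀,
    lmarginal_erase' g hg (Finset.mem_univ j), lmarginal_erase' _ hg' (Finset.mem_univ j)]
  simp only [Function.update_idem, lintegral_const, measure_univ, mul_one]

theorem lintegral_pi_prod_eq_pow {f : E → E → ℝ≥0∞} (hf : Measurable (Function.uncurry f))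
    {c : ℝ≥0∞} (hc : ∀ᵐ a ∂ν, ∫⁻ y, f a y ∂ν = c) {i : ι} {J : Finset ι} (hi : i ∉ J) :
    ∫⁻ x, ∏ j ∈ J, f (x i) (x j) ∂Measure.pi (fun _ => ν) = c ^ J.card := by
  classical
  have hmeas : ∀ J : Finset ι, Measurable fun x : ι → E => ∏ j ∈ J, f (x i) (x j) := fun J =>
    Finset.measurable_prod _ fun j _ =>
      hf.comp (by fun_prop : Measurable fun x : ι → E => (x i, x j))
  induction J using Finset.induction_on with
  | empty => simp
  | insert j J hj ih =>
    obtain ⟨hij, hiJ⟩ : i ≠ j ∧ i ∉ J := by simpa using hi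
    have resample : ∀ (x : ι → E) (y : E),
        ∏ l ∈ insert j J, f (Function.update x j y i) (Function.update x j y l) =
          f (x i) y * ∏ l ∈ J, f (x i) (x l) := fun x y => by
      rw [Finset.prod_insert hj, Function.update_self, Function.update_of_ne hij]
      refine congrArg _ (Finset.prod_congr rfl fun l hl => ?_)
      rw [Function.update_of_ne (ne_of_mem_of_not_mem hl hj)]
    have integrate : ∀ᵐ x ∂Measure.pi fun _ : ι => ν,
        ∫⁻ y, f (x i) y * ∏ l ∈ J, f (x i) (x l) ∂ν = c * ∏ l ∈ J, f (x i) (x l) := by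
      filter_upwards [(measurePreserving_eval (fun _ : ι => ν) i).quasiMeasurePreserving.ae hc]
        with x hx
      rw [lintegral_mul_const _ hf.of_uncurry_left, hx]
    rw [lintegral_pi_eq_lintegral_update ν (hmeas _) j]
    simp only [resample]
    rw [lintegral_congr_ae integrate, lintegral_const_mul _ (hmeas J), ih hiJ,
      Finset.card_insert_of_notMem hj, pow_succ']

end Resampling

instance isProbabilityMeasure_restrict_Icc (d : ℕ) :
    IsProbabilityMeasure ((volume : Measure (Fin d → ℝ)).restrict (Set.Icc 0 1)) :=
  ⟨by simp [Real.volume_Icc_pi]⟩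

instance isProbabilityMeasure_positionLaw (d m : ℕ) : IsProbabilityMeasure (positionLaw d m) := by
  unfold positionLaw
  infer_instance

theorem measurableSet_torusDist_le (d : ℕ) (r : ℝ) :
    MeasurableSet {z : (Fin d → ℝ) × (Fin d → ℝ) | torusDist z.1 z.2 ≤ r} := by
  unfold torusDist
  exact measurableSet_le (by fun_prop) measurable_const

open Classical in
/-- The number of neighbours of the vertex `i` in the set `J`. -/
noncomputable def nbrCount {V : Type*} (G : SimpleGraph V) (i : V) (J : Finset V) : ℕ :=
  (J.filter (G.Adj i)).card

variable {d m : ℕ} {r : ℝ}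

open Classical in
theorem lintegral_ite_torusDist_le (hr : 0 ≤ r) (hr2 : r < 1 / 2) {c : ℝ} (hc : 0 ≤ c)
    {a : Fin d → ℝ} (ha : a ∈ Set.Icc 0 1) :
    ∫⁻ y, (if torusDist a y ≤ r then ENNReal.ofReal c else 1) ∂volume.restrict (Set.Icc 0 1) =
      ENNReal.ofReal (1 + edgeProb d r * (c - 1)) := by
  have hm : MeasurableSet {y | torusDist a y ≤ r} :=
    measurable_prodMk_left (measurableSet_torusDist_le d r)
  have hp := edgeProb_nonneg d hr
  have hp1 := edgeProb_le_one d hr hr2.le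
  calc _ = ENNReal.ofReal c * ENNReal.ofReal (edgeProb d r) +
        (1 - ENNReal.ofReal (edgeProb d r)) := by
        refine (lintegral_piecewise hm _ _).trans ?_
        rw [setLIntegral_const, setLIntegral_const, prob_compl_eq_one_sub hm,
          volume_torusDist_le ha hr hr2, one_mul]
    _ = _ := by
        rw [← ENNReal.ofReal_one, ← ENNReal.ofReal_sub _ hp, ← ENNReal.ofReal_mul hc,
          ← ENNReal.ofReal_add (by positivity) (by linarith)]
        ring_nf

open Classical in
theorem lintegral_pow_nbrCount (hr : 0 ≤ r) (hr2 : r < 1 / 2) {c : ℝ} (hc : 0 ≤ c) {i : Fin m}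
    {J : Finset (Fin m)} (hi : i ∉ J) :
    ∫⁻ x, ENNReal.ofReal c ^ nbrCount (geomGraph r x) i J ∂positionLaw d m =
      ENNReal.ofReal (1 + edgeProb d r * (c - 1)) ^ J.card := by
  have prod_eq : ∀ x : Fin m → Fin d → ℝ, ENNReal.ofReal c ^ nbrCount (geomGraph r x) i J =
      ∏ j ∈ J, if torusDist (x i) (x j) ≤ r then ENNReal.ofReal c else 1 := fun x => by
    rw [← Finset.prod_filter, Finset.prod_const, nbrCount]
    refine congrArg _ (congrArg _ (Finset.filter_congr fun j hj => ?_))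
    exact and_iff_right (ne_of_mem_of_not_mem hj hi).symm
  simp only [prod_eq]
  refine lintegral_pi_prod_eq_pow _ (f := fun a y => if torusDist a y ≤ r then _ else 1)
    (.ite (measurableSet_torusDist_le d r) measurable_const measurable_const) ?_ hi
  filter_upwards [ae_restrict_mem measurableSet_Icc] with a ha
  exact lintegral_ite_torusDist_le hr hr2 hc ha

theorem measurable_nbrCount (r : ℝ) (i : Fin m) (J : Finset (Fin m)) :
    Measurable fun x : Fin m → Fin d → ℝ => nbrCount (geomGraph r x) i J := by
  classical
  simp only [nbrCount, Finset.card_filter]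
  refine Finset.measurable_sum _ fun j _ => .ite ?_ measurable_const measurable_const
  have hij : Measurable fun x : Fin m → Fin d → ℝ => (x i, x j) := by fun_prop
  exact (MeasurableSet.const _).inter (hij (measurableSet_torusDist_le d r))

-- A negative `l` turns the estimate into one for the lower tail.
theorem positionLaw_mul_le_mul_nbrCount_le (hr : 0 ≤ r) (hr2 : r < 1 / 2) (l a : ℝ) {i : Fin m}
    {J : Finset (Fin m)} (hi : i ∉ J) :
    positionLaw d m {x | l * a ≤ l * nbrCount (geomGraph r x) i J} ≤
      ENNReal.ofReal (Real.exp (-(l * a)) *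
        (1 + edgeProb d r * (Real.exp l - 1)) ^ J.card) := by
  have hp := edgeProb_nonneg d hr
  have hp1 := edgeProb_le_one d hr hr2.le
  have base_nonneg : 0 ≤ 1 + edgeProb d r * (Real.exp l - 1) := by
    nlinarith [Real.exp_pos l]
  calc _ ≤ ∫⁻ x, ENNReal.ofReal (Real.exp (-(l * a))) *
        ENNReal.ofReal (Real.exp l) ^ nbrCount (geomGraph r x) i J ∂positionLaw d m := by
        refine meas_le_lintegral₀ ((measurable_from_nat (f := fun q => _ * _ ^ q)).comp
          (measurable_nbrCount r i J)).aemeasurable fun x hx => ?_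
        rw [Function.comp_apply]
        rw [← ENNReal.ofReal_pow (Real.exp_pos l).le, ← ENNReal.ofReal_mul (Real.exp_pos _).le,
          ← Real.exp_nat_mul, ← Real.exp_add, ENNReal.one_le_ofReal, Real.one_le_exp_iff]
        linarith [Set.mem_ofPred_eq ▸ hx]
    _ = _ := by
        rw [lintegral_const_mul' _ _ ENNReal.ofReal_ne_top,
          lintegral_pow_nbrCount hr hr2 (Real.exp_pos l).le hi,
          ENNReal.ofReal_mul (Real.exp_pos _).le, ENNReal.ofReal_pow base_nonneg]

theorem positionLaw_exists_mul_le_mul_nbrCount_le (hr : 0 ≤ r) (hr2 : r < 1 / 2) (l a : ℝ)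
    {I : Finset (Fin m)} {J : Fin m → Finset (Fin m)} {q : ℕ}
    (hJ : ∀ i ∈ I, i ∉ J i ∧ (J i).card = q) :
    positionLaw d m {x | ∃ i ∈ I, l * a ≤ l * nbrCount (geomGraph r x) i (J i)} ≤
      ENNReal.ofReal (I.card * (Real.exp (-(l * a)) *
        (1 + edgeProb d r * (Real.exp l - 1)) ^ q)) := by
  have union : {x : Fin m → Fin d → ℝ | ∃ i ∈ I, l * a ≤ l * nbrCount (geomGraph r x) i (J i)} =
      ⋃ i ∈ I, {x | l * a ≤ l * nbrCount (geomGraph r x) i (J i)} := by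
    ext x
    simp
  rw [union, ENNReal.ofReal_mul (Nat.cast_nonneg _), ENNReal.ofReal_natCast, ← nsmul_eq_mul]
  refine (measure_biUnion_finset_le _ _).trans (Finset.sum_le_card_nsmul _ _ _ fun i hi => ?_)
  rw [← (hJ i hi).2]
  exact positionLaw_mul_le_mul_nbrCount_le hr hr2 l a (hJ i hi).1

end Chernoff

open ProbabilityTheory

/-! ### Sufficient conditions for recovery -/

section Planted

section Deterministic

variable {m : ℕ} {G : SimpleGraph (Fin m)} {K : Finset (Fin m)}

theorem deg_eq_nbrCount_erase (G : SimpleGraph (Fin m)) (i : Fin m) :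
    deg G i = nbrCount G i (Finset.univ.erase i) := by
  classical
  rw [deg, nbrCount, ← Set.ncard_coe_finset]
  congr 1
  ext j
  simp only [SimpleGraph.mem_neighborSet, Finset.coe_filter, Finset.mem_erase, Finset.mem_univ,
    and_true, Set.mem_ofPred_eq]
  exact ⟨fun h => ⟨h.ne', h⟩, And.right⟩

theorem deg_plantClique_of_notMem {j : Fin m} (hj : j ∉ K) :
    deg (plantClique G K) j = deg G j :=
  congrArg Set.ncard (Set.ext fun _ => or_iff_left fun h => hj h.2.1)

theorem card_add_nbrCount_compl_le_deg_plantClique {i : Fin m} (hi : i ∈ K) :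
    K.card + nbrCount G i Kᶜ ≤ deg (plantClique G K) i + 1 := by
  classical
  have disjoint : Disjoint (K.erase i) (Kᶜ.filter (G.Adj i)) :=
    (disjoint_compl_right (a := K)).mono (K.erase_subset i) (Finset.filter_subset _ _)
  have subset : (↑(K.erase i ∪ Kᶜ.filter (G.Adj i)) : Set (Fin m)) ⊆
      (plantClique G K).neighborSet i := by
    intro j hj
    rcases Finset.mem_union.1 hj with h | h
    · obtain ⟨hji, hjK⟩ := Finset.mem_erase.1 h
      exact Or.inr ⟨hji.symm, hi, hjK⟩
    · exact Or.inl (Finset.mem_filter.1 h).2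
  have h := Set.ncard_le_ncard subset (Set.toFinite _)
  rw [Set.ncard_coe_finset, Finset.card_union_of_disjoint disjoint] at h
  rw [← Finset.card_erase_add_one hi, nbrCount, deg]
  lia

theorem isVDOutput_card_iff_eq_of_deg_lt (hlt : ∀ i ∈ K, ∀ j ∉ K, deg G j < deg G i)
    (S : Finset (Fin m)) : IsVDOutput G K.card S ↔ S = K := by
  constructor
  · rintro ⟨hcard, hmax⟩
    by_contra hne
    obtain ⟨j, hjS, hjK⟩ := Finset.not_subset.1 fun h =>
      hne (Finset.eq_of_subset_of_card_le h hcard.ge)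
    obtain ⟨i, hiK, hiS⟩ := Finset.not_subset.1 fun h =>
      hne (Finset.eq_of_subset_of_card_le h hcard.le).symm
    exact (hmax j hjS i hiS).not_gt (hlt i hiK j hjK)
  · rintro rfl
    exact ⟨rfl, fun i hi j hj => (hlt i hi j hj).le⟩

end Deterministic

/-- The event that some vertex has degree at least `s` before the clique is planted. -/
def highDegreeEvent (d : ℕ) (r s : ℝ) : Set (Outcome d) :=
  {ω | ∃ j, s ≤ deg (geomGraph r ω.2.1) j}

/-- The event that some vertex of the planted clique has fewer than `u` neighbours outside the
clique. -/
def lowOuterDegreeEvent (d : ℕ) (r u : ℝ) : Set (Outcome d) :=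
  {ω | ∃ i ∈ ω.2.2, (nbrCount (geomGraph r ω.2.1) i ω.2.2ᶜ : ℝ) < u}

theorem mem_recoveryEvent {d : ℕ} {r s : ℝ} {ω : Outcome d} (hhigh : ω ∉ highDegreeEvent d r s)
    (hlow : ω ∉ lowOuterDegreeEvent d r (s - (ω.2.2.card - 1))) :
    ω ∈ recoveryEvent d r ω.2.2.card := by
  refine isVDOutput_card_iff_eq_of_deg_lt fun i hi j hj => ?_
  rw [deg_plantClique_of_notMem hj]
  have hj_lt : (deg (geomGraph r ω.2.1) j : ℝ) < s := not_le.1 fun h => hhigh ⟨j, h⟩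
  have hi_ge : s - (ω.2.2.card - 1) ≤ nbrCount (geomGraph r ω.2.1) i ω.2.2ᶜ :=
    not_lt.1 fun h => hlow ⟨i, hi, h⟩
  have hdeg : (ω.2.2.card + nbrCount (geomGraph r ω.2.1) i ω.2.2ᶜ : ℝ) ≤
      deg (plantClique (geomGraph r ω.2.1) ω.2.2) i + 1 :=
    mod_cast card_add_nbrCount_compl_le_deg_plantClique hi
  exact_mod_cast (by linarith : (deg (geomGraph r ω.2.1) j : ℝ) <
    deg (plantClique (geomGraph r ω.2.1) ω.2.2) i)

/-- The uniform distribution on the sets of `k` among `m` vertices; it is zero when `m < k`. -/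
noncomputable abbrev cliqueLaw (m k : ℕ) : Measure (Finset (Fin m)) :=
  uniformOn (↑(Finset.powersetCard k (Finset.univ : Finset (Fin m))) : Set (Finset (Fin m)))

theorem cliqueLaw_univ (m k : ℕ) : cliqueLaw m k Set.univ = if k ≤ m then 1 else 0 := by
  split_ifs with h
  · have := isProbabilityMeasure_uniformOn (Finset.finite_toSet _)
      (Finset.coe_nonempty.2 (Finset.powersetCard_nonempty.2
        (by simpa using h : k ≤ (Finset.univ : Finset (Fin m)).card)))
    exact measure_univ
  · rw [cliqueLaw, Finset.powersetCard_eq_empty.2 (by simpa using h), Finset.coe_empty,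
      uniformOn_empty_meas, Measure.coe_zero, Pi.zero_apply]

instance isFiniteMeasure_cliqueLaw (m k : ℕ) : IsFiniteMeasure (cliqueLaw m k) :=
  ⟨by rw [cliqueLaw_univ]; split_ifs <;> simp⟩

theorem ae_card_eq_cliqueLaw (m k : ℕ) : ∀ᵐ K ∂cliqueLaw m k, K.card = k := by
  refine (uniformOn_eq_zero_iff (Finset.finite_toSet _)).2 ?_
  ext K
  simp [Finset.mem_powersetCard]

theorem prod_apply_le_mul_of_countable {α β : Type*} [MeasurableSpace α] [MeasurableSpace β]
    [Countable β] [MeasurableSingletonClass β] {μ : Measure α} {ν : Measure β} [SFinite ν]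
    {S : Set (α × β)} {c : ℝ≥0∞} (h : ∀ᵐ y ∂ν, μ {x | (x, y) ∈ S} ≤ c) :
    μ.prod ν S ≤ c * ν Set.univ := by
  have cover : S ⊆ ⋃ y, {x | (x, y) ∈ S} ×ˢ {y} := fun z hz => Set.mem_iUnion.2 ⟨z.2, hz, rfl⟩
  calc μ.prod ν S ≤ ∑' y, μ {x | (x, y) ∈ S} * ν {y} := by
        simpa only [Measure.prod_prod] using
          (measure_mono (μ := μ.prod ν) cover).trans (measure_iUnion_le _)
    _ = ∫⁻ y, μ {x | (x, y) ∈ S} ∂ν := (lintegral_countable' _).symm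
    _ ≤ ∫⁻ _, c ∂ν := lintegral_mono_ae h
    _ = c * ν Set.univ := lintegral_const c

theorem measurableEmbedding_sigmaMk {ι : Type*} {β : ι → Type*} [∀ i, MeasurableSpace (β i)]
    (i : ι) : MeasurableEmbedding (Sigma.mk i : β i → Sigma β) where
  injective := sigma_mk_injective
  measurable := fun _ hs => MeasurableSpace.measurableSet_iInf.1 hs i
  measurableSet_image' := fun s hs => MeasurableSpace.measurableSet_iInf.2 fun j => by
    change MeasurableSet (Sigma.mk j ⁻¹' (Sigma.mk i '' s))
    rcases eq_or_ne j i with rfl | h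
    · rwa [Set.preimage_image_eq _ sigma_mk_injective]
    · rw [Set.preimage_image_sigmaMk_of_ne h]
      exact .empty

variable {d n k : ℕ}

theorem plantedLaw_apply (S : Set (Outcome d)) :
    plantedLaw d n k S = ∑' m : ℕ, poissonMeasure (n : ℝ≥0) {m} *
      (positionLaw d m).prod (cliqueLaw m k) {z | (⟨m, z⟩ : Outcome d) ∈ S} := by
  rw [plantedLaw, Measure.sum_apply_of_countable]
  refine tsum_congr fun m => ?_
  rw [Measure.smul_apply, (measurableEmbedding_sigmaMk m).map_apply, smul_eq_mul]
  rfl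

theorem plantedLaw_univ : plantedLaw d n k Set.univ = poissonMeasure (n : ℝ≥0) {m | k ≤ m} := by
  rw [plantedLaw_apply, ← Measure.tsum_indicator_apply_singleton _ _ .of_discrete]
  refine tsum_congr fun m => ?_
  simp only [Set.mem_univ, Set.ofPred_true]
  rw [← Set.univ_prod_univ, Measure.prod_prod, measure_univ, one_mul,
    cliqueLaw_univ, mul_ite, mul_one, mul_zero, Set.indicator_apply]
  exact if_congr Iff.rfl rfl rfl

theorem ae_card_eq_plantedLaw : ∀ᵐ ω ∂plantedLaw d n k, ω.2.2.card = k := by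
  refine (plantedLaw_apply _).trans (ENNReal.tsum_eq_zero.2 fun m => ?_)
  exact mul_eq_zero_of_right _ (Measure.quasiMeasurePreserving_snd.ae (ae_card_eq_cliqueLaw m k))

theorem plantedLaw_apply_le {S : Set (Outcome d)} {b : ℕ → ℝ≥0∞}
    (h : ∀ m K, K.card = k → positionLaw d m {x | (⟨m, x, K⟩ : Outcome d) ∈ S} ≤ b m) :
    plantedLaw d n k S ≤ ∑' m : ℕ, poissonMeasure (n : ℝ≥0) {m} * b m := by
  rw [plantedLaw_apply]
  refine ENNReal.tsum_le_tsum fun m => mul_le_mul_right ?_ _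
  have slices : ∀ᵐ K ∂cliqueLaw m k,
      positionLaw d m {x | (x, K) ∈ {z | (⟨m, z⟩ : Outcome d) ∈ S}} ≤ b m := by
    filter_upwards [ae_card_eq_cliqueLaw m k] with K hK
    exact h m K hK
  refine (prod_apply_le_mul_of_countable slices).trans (mul_le_of_le_one_right' ?_)
  rw [cliqueLaw_univ]
  split_ifs <;> simp

theorem plantedLaw_compl_recoveryEvent_le (r s : ℝ) :
    plantedLaw d n k (recoveryEvent d r k)ᶜ ≤
      plantedLaw d n k (highDegreeEvent d r s) +
        plantedLaw d n k (lowOuterDegreeEvent d r (s - (k - 1))) := by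
  refine (measure_mono_ae ?_).trans (measure_union_le _ _)
  filter_upwards [ae_card_eq_plantedLaw] with ω hω hfail
  by_contra h
  obtain ⟨hhigh, hlow⟩ := not_or.1 h
  rw [← hω] at hlow
  exact hfail (hω ▸ mem_recoveryEvent hhigh hlow)

theorem vdRecovers_of_tendsto {r : ℕ → ℝ} {k : ℕ → ℕ} (s : ℕ → ℝ) (hplant : Plantable k)
    (hhigh : Tendsto (fun n => plantedLaw d n (k n) (highDegreeEvent d (r n) (s n))) atTop (𝓝 0))
    (hlow : Tendsto (fun n => plantedLaw d n (k n)
      (lowOuterDegreeEvent d (r n) (s n - (k n - 1)))) atTop (𝓝 0)) :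
    VDRecovers d r k := by
  have hsub := ENNReal.Tendsto.sub hplant (hhigh.add hlow) (Or.inl ENNReal.one_ne_top)
  rw [add_zero, tsub_zero] at hsub
  refine tendsto_of_tendsto_of_tendsto_of_le_of_le hsub hplant (fun n => ?_) fun n => ?_
  · rw [tsub_le_iff_right, ← plantedLaw_univ (d := d)]
    exact (measure_univ_le_add_compl _).trans
      (add_le_add_right (plantedLaw_compl_recoveryEvent_le (r n) (s n)) _)
  · rw [← plantedLaw_univ (d := d)]
    exact measure_mono (Set.subset_univ _)

end Planted

/-! ### Averaging over the number of vertices -/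

section Poisson

theorem poissonMeasure_singleton_mul_pow (c y : ℝ≥0) (m : ℕ) :
    poissonMeasure c {m} * (y : ℝ≥0∞) ^ m =
      ENNReal.ofReal (Real.exp (c * (y - 1))) * poissonMeasure (c * y) {m} := by
  rw [poissonMeasure_singleton, poissonMeasure_singleton, ← ENNReal.ofReal_coe_nnreal,
    ← ENNReal.ofReal_pow y.coe_nonneg, ← ENNReal.ofReal_mul (by positivity),
    ← ENNReal.ofReal_mul (by positivity), NNReal.coe_mul, mul_pow,
    show Real.exp (-c) = Real.exp (c * (y - 1)) * Real.exp (-(c * y)) by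
      rw [← Real.exp_add]; ring_nf]
  ring_nf

theorem tsum_poissonMeasure_mul_pow (c y : ℝ≥0) :
    ∑' m : ℕ, poissonMeasure c {m} * (y : ℝ≥0∞) ^ m =
      ENNReal.ofReal (Real.exp (c * (y - 1))) := by
  simp only [poissonMeasure_singleton_mul_pow]
  have total : ∑' m : ℕ, poissonMeasure (c * y) {m} = 1 := by
    simpa using Measure.tsum_indicator_apply_singleton (poissonMeasure (c * y)) Set.univ .univ
  rw [ENNReal.tsum_mul_left, total, mul_one]

theorem tsum_poissonMeasure_mul_natCast_mul (c : ℝ≥0) (f : ℕ → ℝ≥0∞) :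
    ∑' m : ℕ, poissonMeasure c {m} * (m * f (m - 1)) =
      c * ∑' m : ℕ, poissonMeasure c {m} * f m := by
  have shift : ∀ m : ℕ, poissonMeasure c {m + 1} * (m + 1 : ℕ) = c * poissonMeasure c {m} := by
    intro m
    rw [poissonMeasure_singleton, poissonMeasure_singleton, ← ENNReal.ofReal_natCast,
      ← ENNReal.ofReal_coe_nnreal, ← ENNReal.ofReal_mul (by positivity),
      ← ENNReal.ofReal_mul c.coe_nonneg, Nat.factorial_succ, Nat.cast_mul]
    field_simp
    ring_nf
  rw [tsum_eq_zero_add' ENNReal.summable, Nat.cast_zero, zero_mul, mul_zero, zero_add,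
    ← ENNReal.tsum_mul_left]
  refine tsum_congr fun m => ?_
  rw [Nat.add_sub_cancel, ← mul_assoc, shift, mul_assoc]

variable {d n k : ℕ} {r : ℝ}

theorem positionLaw_exists_le_deg_le {m : ℕ} (hr : 0 ≤ r) (hr2 : r < 1 / 2) {A : ℝ} (hA : 1 ≤ A)
    (s : ℝ) :
    positionLaw d m {x | ∃ i, s ≤ deg (geomGraph r x) i} ≤
      ENNReal.ofReal (m * (Real.exp (-(Real.log A * s)) *
        (1 + edgeProb d r * (A - 1)) ^ (m - 1))) := by
  have union := positionLaw_exists_mul_le_mul_nbrCount_le (d := d) hr hr2 (Real.log A) s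
    (I := Finset.univ) (J := fun i : Fin m => Finset.univ.erase i) (q := m - 1) (by simp)
  rw [Finset.card_univ, Fintype.card_fin, Real.exp_log (by linarith)] at union
  refine (measure_mono ?_).trans union
  rintro x ⟨i, hi⟩
  rw [deg_eq_nbrCount_erase] at hi
  exact ⟨i, Finset.mem_univ i, mul_le_mul_of_nonneg_left hi (Real.log_nonneg hA)⟩

theorem positionLaw_exists_nbrCount_compl_lt_le {m : ℕ} (hr : 0 ≤ r) (hr2 : r < 1 / 2) {a : ℝ}
    (ha : 0 < a) (ha1 : a ≤ 1) (u : ℝ) (K : Finset (Fin m)) :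
    positionLaw d m {x | ∃ i ∈ K, (nbrCount (geomGraph r x) i Kᶜ : ℝ) < u} ≤
      ENNReal.ofReal (K.card * (Real.exp (-(Real.log a * u)) *
        (1 + edgeProb d r * (a - 1)) ^ (m - K.card))) := by
  have union := positionLaw_exists_mul_le_mul_nbrCount_le (d := d) hr hr2 (Real.log a) u
    (I := K) (J := fun _ => Kᶜ) (q := m - K.card)
    fun i hi => ⟨by simpa using hi, by rw [Finset.card_compl, Fintype.card_fin]⟩
  rw [Real.exp_log ha] at union
  refine (measure_mono ?_).trans union
  rintro x ⟨i, hi, hlt⟩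
  exact ⟨i, hi, mul_le_mul_of_nonpos_left hlt.le (Real.log_nonpos ha.le ha1)⟩

theorem plantedLaw_highDegreeEvent_le (hr : 0 ≤ r) (hr2 : r < 1 / 2) {A : ℝ} (hA : 1 ≤ A) :
    plantedLaw d n k (highDegreeEvent d r (A * (n * edgeProb d r))) ≤
      ENNReal.ofReal (n * Real.exp (-(n * edgeProb d r * entropyH A))) := by
  set p := edgeProb d r with hp
  have hp0 : 0 ≤ p := edgeProb_nonneg d hr
  lift 1 + p * (A - 1) to ℝ≥0 using by nlinarith with y hy
  have conditional : ∀ m (K : Finset (Fin m)), K.card = k →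
      positionLaw d m {x | (⟨m, x, K⟩ : Outcome d) ∈ highDegreeEvent d r (A * (n * p))} ≤
        m * (ENNReal.ofReal (Real.exp (-(Real.log A * (A * (n * p))))) * (y : ℝ≥0∞) ^ (m - 1)) := by
    intro m K _
    refine (positionLaw_exists_le_deg_le hr hr2 hA _).trans_eq ?_
    rw [← hp, ← hy, ENNReal.ofReal_mul (Nat.cast_nonneg m), ENNReal.ofReal_mul (Real.exp_pos _).le,
      ENNReal.ofReal_pow y.coe_nonneg, ENNReal.ofReal_natCast, ENNReal.ofReal_coe_nnreal]
  refine (plantedLaw_apply_le conditional).trans_eq ?_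
  rw [tsum_poissonMeasure_mul_natCast_mul _ fun q => _ * (y : ℝ≥0∞) ^ q]
  simp only [mul_left_comm (poissonMeasure (n : ℝ≥0) {_})]
  rw [ENNReal.tsum_mul_left, tsum_poissonMeasure_mul_pow, ← ENNReal.ofReal_mul (Real.exp_pos _).le,
    ← Real.exp_add, hy, ENNReal.ofReal_mul (Nat.cast_nonneg n), ENNReal.ofReal_natCast, entropyH]
  congr 3
  push_cast
  ring

theorem lowOuterDegreeEvent_of_nonpos {u : ℝ} (hu : u ≤ 0) : lowOuterDegreeEvent d r u = ∅ :=
  Set.eq_empty_of_forall_notMem fun _ ⟨_, _, h⟩ => (h.trans_le hu).not_ge (Nat.cast_nonneg _)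

theorem inv_pow_le_exp_mul_div {q : ℝ} (hq : q < 1) (k : ℕ) :
    (1 - q)⁻¹ ^ k ≤ Real.exp (k * (q / (1 - q))) := by
  rw [Real.exp_nat_mul]
  have hq' : 0 < 1 - q := by linarith
  refine pow_le_pow_left₀ (inv_nonneg.2 hq'.le) ?_ k
  calc (1 - q)⁻¹ = q / (1 - q) + 1 := by field_simp; ring
    _ ≤ Real.exp (q / (1 - q)) := Real.add_one_le_exp _

theorem plantedLaw_lowOuterDegreeEvent_le (hr : 0 ≤ r) (hr2 : r < 1 / 2) {a : ℝ} (ha : 0 < a)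
    (ha1 : a ≤ 1) {q : ℝ} (hq : q = edgeProb d r * (1 - a)) (hq1 : q < 1) (u : ℝ) :
    plantedLaw d n k (lowOuterDegreeEvent d r u) ≤
      ENNReal.ofReal (k * Real.exp (-(u * Real.log a + n * q - k * (q / (1 - q))))) := by
  have hq' : 0 < 1 - q := by linarith
  lift 1 - q to ℝ≥0 using hq'.le with y hy
  have conditional : ∀ m (K : Finset (Fin m)), K.card = k →
      positionLaw d m {x | (⟨m, x, K⟩ : Outcome d) ∈ lowOuterDegreeEvent d r u} ≤
        ENNReal.ofReal (k * (Real.exp (-(Real.log a * u)) * (y : ℝ)⁻¹ ^ k)) * (y : ℝ≥0∞) ^ m := by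
    intro m K hK
    have hkm : k ≤ m := by simpa [hK] using K.card_le_univ
    refine (positionLaw_exists_nbrCount_compl_lt_le hr hr2 ha ha1 u K).trans_eq ?_
    rw [show 1 + edgeProb d r * (a - 1) = y by rw [hy, hq]; ring, hK, pow_sub₀ _ hq'.ne' hkm,
      ← ENNReal.ofReal_coe_nnreal, ← ENNReal.ofReal_pow y.coe_nonneg,
      ← ENNReal.ofReal_mul (by positivity), inv_pow]
    ring_nf
  refine (plantedLaw_apply_le conditional).trans ?_
  simp only [mul_left_comm (poissonMeasure (n : ℝ≥0) {_})]
  rw [ENNReal.tsum_mul_left, tsum_poissonMeasure_mul_pow, ← ENNReal.ofReal_mul (by positivity)]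
  refine ENNReal.ofReal_le_ofReal ?_
  calc _ ≤ k * (Real.exp (-(Real.log a * u)) * Real.exp (k * (q / (1 - q)))) *
        Real.exp (n * (y - 1)) := by
        rw [NNReal.coe_natCast]
        gcongr
        exact hy ▸ inv_pow_le_exp_mul_div hq1 k
    _ = _ := by
        rw [← Real.exp_add, mul_assoc, ← Real.exp_add, hy]
        ring_nf

end Poisson

/-! ### The regimes of the mean degree -/

section Regimes

theorem tendsto_natCast_log_atTop : Tendsto (fun n : ℕ => Real.log n) atTop atTop :=
  Real.tendsto_log_atTop.comp tendsto_natCast_atTop_atTop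

theorem tendsto_ofReal_mul_natCast_mul_exp_neg {c : ℝ} (hc : 1 < c) (C : ℝ) :
    Tendsto (fun n : ℕ => ENNReal.ofReal (C * (n * Real.exp (-(c * Real.log n))))) atTop (𝓝 0) := by
  have power : (fun n : ℕ => (n : ℝ) ^ (-(c - 1))) =ᶠ[atTop]
      fun n => n * Real.exp (-(c * Real.log n)) := by
    filter_upwards [eventually_gt_atTop 0] with n hn
    have hn' : (0 : ℝ) < n := Nat.cast_pos.2 hn
    nth_rewrite 2 [← Real.exp_log hn']
    rw [Real.rpow_def_of_pos hn', ← Real.exp_add]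
    ring_nf
  have limit : Tendsto (fun n : ℕ => (n : ℝ) ^ (-(c - 1))) atTop (𝓝 0) :=
    (tendsto_rpow_neg_atTop (sub_pos.2 hc)).comp tendsto_natCast_atTop_atTop
  simpa using ENNReal.tendsto_ofReal ((limit.congr' power).const_mul C)

theorem exists_mul_log_le_of_tendsto_div_log {x : ℕ → ℝ} {L : ℝ} (hL : 1 < L)
    (hx : Tendsto (fun n : ℕ => x n / Real.log n) atTop (𝓝 L)) :
    ∃ c > 1, ∀ᶠ n : ℕ in atTop, c * Real.log n ≤ x n := by
  obtain ⟨c, hc, hcL⟩ := exists_between hL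
  refine ⟨c, hc, ?_⟩
  filter_upwards [hx.eventually (eventually_ge_nhds hcL),
    tendsto_natCast_log_atTop.eventually_gt_atTop 0] with n h hlog
  exact (le_div_iff₀ hlog).1 h

theorem eventually_mul_log_le_of_tendsto_div_log_atTop {x : ℕ → ℝ}
    (hx : Tendsto (fun n : ℕ => x n / Real.log n) atTop atTop) (c : ℝ) :
    ∀ᶠ n : ℕ in atTop, c * Real.log n ≤ x n := by
  filter_upwards [hx.eventually_ge_atTop c, tendsto_natCast_log_atTop.eventually_gt_atTop 0]
    with n h hlog
  exact (le_div_iff₀ hlog).1 h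

variable {d : ℕ} {r : ℕ → ℝ} {k : ℕ → ℕ}

theorem meanDegree_eq (d : ℕ) (r : ℕ → ℝ) (n : ℕ) :
    meanDegree d r n = n * edgeProb d (r n) :=
  mul_assoc _ _ _

theorem meanDegree_nonneg (hr : ∀ n, 0 ≤ r n) (n : ℕ) : 0 ≤ meanDegree d r n := by
  rw [meanDegree_eq]
  exact mul_nonneg (Nat.cast_nonneg n) (edgeProb_nonneg d (hr n))

theorem tendsto_plantedLaw_highDegreeEvent (hr : ∀ n, 0 ≤ r n ∧ r n < 1 / 2) {A : ℕ → ℝ}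
    (hA : ∀ᶠ n in atTop, 1 ≤ A n) {c : ℝ} (hc : 1 < c)
    (h : ∀ᶠ n : ℕ in atTop, c * Real.log n ≤ meanDegree d r n * entropyH (A n)) :
    Tendsto (fun n => plantedLaw d n (k n) (highDegreeEvent d (r n) (A n * meanDegree d r n)))
      atTop (𝓝 0) := by
  refine tendsto_of_tendsto_of_tendsto_of_le_of_le' tendsto_const_nhds
    (tendsto_ofReal_mul_natCast_mul_exp_neg hc 1) (.of_forall fun _ => zero_le) ?_
  filter_upwards [hA, h] with n hAn hn
  rw [meanDegree_eq] at hn ⊢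
  refine (plantedLaw_highDegreeEvent_le (hr n).1 (hr n).2 hAn).trans ?_
  rw [one_mul]
  gcongr

theorem tendsto_plantedLaw_lowOuterDegreeEvent (hr : ∀ n, 0 ≤ r n ∧ r n < 1 / 2) {a : ℝ}
    (ha : 0 < a) (ha1 : a ≤ 1) {q : ℕ → ℝ} (hq : ∀ n, q n = edgeProb d (r n) * (1 - a))
    {u : ℕ → ℝ} {c C : ℝ} (hc : 1 < c)
    (h : ∀ᶠ n : ℕ in atTop, 0 < u n → q n < 1 ∧ k n ≤ C * n ∧
      c * Real.log n ≤ u n * Real.log a + n * q n - k n * (q n / (1 - q n))) :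
    Tendsto (fun n => plantedLaw d n (k n) (lowOuterDegreeEvent d (r n) (u n))) atTop (𝓝 0) := by
  refine tendsto_of_tendsto_of_tendsto_of_le_of_le' tendsto_const_nhds
    (tendsto_ofReal_mul_natCast_mul_exp_neg hc C) (.of_forall fun _ => zero_le) ?_
  filter_upwards [h] with n hn
  rcases le_or_gt (u n) 0 with hu | hu
  · rw [lowOuterDegreeEvent_of_nonpos hu, measure_empty]
    exact zero_le
  · obtain ⟨hq1, hkn, hlog⟩ := hn hu
    refine (plantedLaw_lowOuterDegreeEvent_le (hr n).1 (hr n).2 ha ha1 (hq n) hq1 (u n)).trans ?_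
    rw [← mul_assoc]
    gcongr
    exact (Nat.cast_nonneg _).trans hkn

theorem entropyH_pos_of_one_lt {A : ℝ} (hA : 1 < A) : 0 < entropyH A := by
  simpa [entropyH] using strictMonoOn_entropyH Set.self_mem_Ici hA.le hA

theorem mul_div_one_sub_le {δ c p : ℝ} (hδ : 0 ≤ δ) (hδ1 : δ < 1) (hp : 0 ≤ p) (hpc : p ≤ c)
    (hc : c ≤ 1) : p * δ / (1 - p * δ) ≤ c * (δ / (1 - δ)) := by
  rw [← mul_div_assoc]
  have : p * δ ≤ δ := mul_le_of_le_one_left hδ (hpc.trans hc)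
  exact div_le_div₀ (mul_nonneg (hp.trans hpc) hδ) (by gcongr) (by linarith) (by linarith)

theorem superlogarithmic_exponent_ge {ε c δ p μ k : ℝ} (hδ : 0 < δ) (hδ1 : δ < 1)
    (hδε : 4 * δ ≤ ε * (1 - c)) (hc : c ≤ 1) (hp : 0 ≤ p) (hpc : p ≤ c) (hμ : 0 ≤ μ)
    (hk : ε * μ ≤ k) (hk0 : 0 ≤ k) (hu : 0 ≤ (1 + δ) * μ - (k - 1)) :
    δ / (1 - δ) * (ε * (1 - c) / 2 * μ - 1) ≤
      ((1 + δ) * μ - (k - 1)) * Real.log (1 - δ) + μ * δ - k * (p * δ / (1 - p * δ)) := by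
  have hδ' : 0 < 1 - δ := by linarith
  have hlog : -(δ / (1 - δ)) ≤ Real.log (1 - δ) :=
    (by field_simp; ring : -(δ / (1 - δ)) = 1 - (1 - δ)⁻¹).trans_le
      (Real.one_sub_inv_le_log_of_pos hδ')
  have hδμ : μ * δ = δ / (1 - δ) * ((1 - δ) * μ) := by field_simp
  have hkμ : ε * (1 - c) / 2 * μ ≤ (1 - c) * k - 2 * δ * μ := by
    nlinarith [mul_le_mul_of_nonneg_left hk (sub_nonneg.2 hc),
      mul_le_mul_of_nonneg_right hδε hμ]
  calc _ ≤ δ / (1 - δ) * ((1 - c) * k - 2 * δ * μ - 1) := by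
        gcongr
    _ = ((1 + δ) * μ - (k - 1)) * -(δ / (1 - δ)) + μ * δ - k * (c * (δ / (1 - δ))) := by
        rw [hδμ]
        ring
    _ ≤ _ := by
        gcongr
        exact mul_div_one_sub_le hδ.le hδ1 hp hpc hc

theorem vdRecovers_of_superlogarithmic (hr : ∀ n, 0 ≤ r n ∧ r n < 1 / 2) {c : ℝ} (hc : c < 1)
    (hp : ∀ n, edgeProb d (r n) ≤ c) (hplant : Plantable k) {ε : ℝ} (hε : 0 < ε)
    (hlim : Tendsto (fun n : ℕ => meanDegree d r n / Real.log n) atTop atTop)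
    (hk : ∀ᶠ n in atTop, ε * meanDegree d r n < k n) : VDRecovers d r k := by
  -- With `δ` of order `ε (1 - c)`, the degree gain outweighs the deviations `δ μ`.
  obtain ⟨δ, hδ, hδ_lt⟩ := exists_between
    (lt_min one_pos (by have := sub_pos.2 hc; positivity : 0 < ε * (1 - c) / 4))
  obtain ⟨hδ1, hδε⟩ := lt_min_iff.1 hδ_lt
  have hδ' : 0 < 1 - δ := by linarith
  have hμ : ∀ n, 0 ≤ meanDegree d r n := meanDegree_nonneg fun n => (hr n).1
  refine vdRecovers_of_tendsto (fun n => (1 + δ) * meanDegree d r n) hplant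
    (tendsto_plantedLaw_highDegreeEvent hr (.of_forall fun _ => by linarith) one_lt_two ?_)
    (tendsto_plantedLaw_lowOuterDegreeEvent hr (a := 1 - δ) hδ' (by linarith) (fun _ => rfl)
      (C := 3) one_lt_two ?_)
  · have hH := entropyH_pos_of_one_lt (lt_add_of_pos_right 1 hδ)
    filter_upwards [eventually_mul_log_le_of_tendsto_div_log_atTop hlim (2 / entropyH (1 + δ))]
      with n hn
    rwa [div_mul_eq_mul_div, div_le_iff₀ hH] at hn
  · set b := δ / (1 - δ) * (ε * (1 - c) / 2) with hb
    have hb0 : 0 < b := by have := sub_pos.2 hc; positivity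
    filter_upwards [hk, tendsto_natCast_log_atTop.eventually_ge_atTop (δ / (1 - δ)),
      eventually_ge_atTop 1,
      eventually_mul_log_le_of_tendsto_div_log_atTop hlim (3 / b)] with n hkn hlog hn1 hn hu
    have hn1' : (1 : ℝ) ≤ n := mod_cast hn1
    have hp0 := edgeProb_nonneg d (hr n).1
    have hμn : meanDegree d r n ≤ n := by
      rw [meanDegree_eq]
      exact mul_le_of_le_one_right (Nat.cast_nonneg n) ((hp n).trans hc.le)
    have hexp := superlogarithmic_exponent_ge hδ hδ1 (by linarith) hc.le hp0 (hp n) (hμ n)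
      hkn.le (Nat.cast_nonneg _) hu.le
    rw [div_mul_eq_mul_div, div_le_iff₀ hb0] at hn
    rw [sub_sub_cancel, ← mul_assoc, ← meanDegree_eq]
    refine ⟨?_, ?_, le_trans ?_ hexp⟩
    · nlinarith [hp n]
    · nlinarith [hμ n]
    · rw [hb] at hn
      linarith

theorem minDegAsymp_eq_mul (α μ : ℝ) : minDegAsymp α μ = μ * minDegAsymp α 1 := by
  simp only [minDegAsymp, mul_ite, mul_zero, one_mul]

theorem minDegAsymp_one_le_one (α : ℝ) : minDegAsymp α 1 ≤ 1 := by
  rw [minDegAsymp]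
  split_ifs with h
  · exact zero_le_one
  · rw [one_mul]
    exact (HinvMinus_spec (inv_nonneg.2 (by linarith)) (inv_le_one_of_one_le₀ (not_lt.1 h))).1.2

theorem one_lt_mul_entropyH_of_lt_minDegAsymp {α a : ℝ} (ha : 0 ≤ a) (h : a < minDegAsymp α 1) :
    1 < α * entropyH a := by
  rw [minDegAsymp] at h
  split_ifs at h with hα
  · exact absurd h ha.not_gt
  · have hα0 : 0 < α := by linarith
    obtain ⟨hb, hHb⟩ :=
      HinvMinus_spec (inv_nonneg.2 hα0.le) (inv_le_one_of_one_le₀ (not_lt.1 hα))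
    rw [one_mul] at h
    have := strictAntiOn_entropyH ⟨ha, h.le.trans hb.2⟩ hb h
    rwa [hHb, inv_lt_iff_one_lt_mul₀' hα0] at this

theorem one_lt_HinvPlus {y : ℝ} (hy : 0 < y) : 1 < HinvPlus y := by
  obtain ⟨h, hH⟩ := HinvPlus_spec hy.le
  refine h.lt_of_ne fun h1 => hy.ne ?_
  rw [← hH, ← h1]
  simp [entropyH]

theorem one_lt_mul_entropyH_of_HinvPlus_lt {α A : ℝ} (hα : 0 < α) (h : HinvPlus α⁻¹ < A) :
    1 < α * entropyH A := by
  obtain ⟨hB, hHB⟩ := HinvPlus_spec (inv_nonneg.2 hα.le)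
  have := strictMonoOn_entropyH hB (hB.trans h.le) h
  rwa [hHB, inv_lt_iff_one_lt_mul₀' hα] at this

theorem tendsto_meanDegree_atTop {α : ℝ} (hα : 0 < α)
    (hlim : Tendsto (fun n : ℕ => meanDegree d r n / Real.log n) atTop (𝓝 α)) :
    Tendsto (meanDegree d r) atTop atTop := by
  refine (hlim.pos_mul_atTop hα tendsto_natCast_log_atTop).congr' ?_
  filter_upwards [tendsto_natCast_log_atTop.eventually_gt_atTop 0] with n hn
  exact div_mul_cancel₀ _ hn.ne'

theorem tendsto_edgeProb_zero {α : ℝ}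
    (hlim : Tendsto (fun n : ℕ => meanDegree d r n / Real.log n) atTop (𝓝 α)) :
    Tendsto (fun n => edgeProb d (r n)) atTop (𝓝 0) := by
  have hlog : Tendsto (fun n : ℕ => Real.log n / n) atTop (𝓝 0) :=
    Real.isLittleO_log_id_atTop.tendsto_div_nhds_zero.comp tendsto_natCast_atTop_atTop
  have h := hlim.mul hlog
  rw [mul_zero] at h
  refine h.congr' ?_
  filter_upwards [tendsto_natCast_log_atTop.eventually_gt_atTop 0, eventually_gt_atTop 0]
    with n hn hn0
  have hn0' : (n : ℝ) ≠ 0 := Nat.cast_ne_zero.2 hn0.ne'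
  rw [meanDegree_eq]
  field_simp

theorem logarithmic_exponent_ge {a A p μ k u : ℝ} (ha : 0 < a) (ha1 : a ≤ 1) (hp : 0 ≤ p)
    (hp1 : p ≤ 1) (hu : u ≤ a * μ) (hk : 0 ≤ k) (hkA : k ≤ A * μ) :
    μ * (entropyH a - A * ((1 - a) / a) * p) ≤
      u * Real.log a + μ * (1 - a) - k * (p * (1 - a) / (1 - p * (1 - a))) := by
  have ha' : 0 ≤ 1 - a := sub_nonneg.2 ha1
  have hodds := mul_div_one_sub_le ha' (by linarith) hp le_rfl hp1
  rw [sub_sub_cancel] at hodds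
  calc μ * (entropyH a - A * ((1 - a) / a) * p)
      = a * μ * Real.log a + μ * (1 - a) - A * μ * (p * ((1 - a) / a)) := by
        rw [entropyH]
        ring
    _ ≤ u * Real.log a + μ * (1 - a) - k * (p * (1 - a) / (1 - p * (1 - a))) := by
        refine sub_le_sub (add_le_add_left ?_ _) (mul_le_mul hkA hodds ?_ (hk.trans hkA))
        · exact mul_le_mul_of_nonpos_right hu (Real.log_nonpos ha.le ha1)
        · exact div_nonneg (mul_nonneg hp ha')
            (by linarith [mul_le_of_le_one_left ha' hp1])

theorem tendsto_plantedLaw_lowOuterDegreeEvent_of_logarithmic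
    (hr : ∀ n, 0 ≤ r n ∧ r n < 1 / 2) {α : ℝ}
    (hlim : Tendsto (fun n : ℕ => meanDegree d r n / Real.log n) atTop (𝓝 α)) {a A : ℝ}
    (ha : 0 < a) (ha1 : a ≤ 1) (hαa : 1 < α * entropyH a) (hA : 0 ≤ A) {u : ℕ → ℝ}
    (hu : ∀ᶠ n in atTop, u n ≤ a * meanDegree d r n)
    (hk : ∀ᶠ n in atTop, 0 < u n → k n ≤ A * meanDegree d r n) :
    Tendsto (fun n => plantedLaw d n (k n) (lowOuterDegreeEvent d (r n) (u n))) atTop (𝓝 0) := by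
  have hexponent : Tendsto (fun n : ℕ => meanDegree d r n *
      (entropyH a - A * ((1 - a) / a) * edgeProb d (r n)) / Real.log n) atTop
      (𝓝 (α * entropyH a)) := by
    have h := hlim.mul (tendsto_const_nhds.sub ((tendsto_edgeProb_zero hlim).const_mul
      (A * ((1 - a) / a))) : Tendsto _ atTop (𝓝 (entropyH a - _)))
    rw [mul_zero, sub_zero] at h
    exact h.congr fun n => div_mul_eq_mul_div _ _ _
  obtain ⟨c, hc, hcn⟩ := exists_mul_log_le_of_tendsto_div_log hαa hexponent
  refine tendsto_plantedLaw_lowOuterDegreeEvent hr (C := A) ha ha1 (fun _ => rfl) hc ?_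
  filter_upwards [hu, hk, hcn] with n hun hkn hn hu0
  have hp := edgeProb_nonneg d (hr n).1
  have hp1 : edgeProb d (r n) ≤ 1 := edgeProb_le_one d (hr n).1 (hr n).2.le
  have hμn : meanDegree d r n ≤ n := by
    rw [meanDegree_eq]
    exact mul_le_of_le_one_right (Nat.cast_nonneg n) hp1
  refine ⟨?_, (hkn hu0).trans (by gcongr), hn.trans ?_⟩
  · linarith [mul_le_of_le_one_left (sub_nonneg.2 ha1) hp1]
  · rw [← mul_assoc, ← meanDegree_eq]
    exact logarithmic_exponent_ge ha ha1 hp hp1 hun (Nat.cast_nonneg _) (hkn hu0)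

theorem vdRecovers_of_logarithmic (hr : ∀ n, 0 ≤ r n ∧ r n < 1 / 2) (hplant : Plantable k)
    {ε : ℝ} (hε : 0 < ε) {α : ℝ} (hα : 0 < α)
    (hlim : Tendsto (fun n : ℕ => meanDegree d r n / Real.log n) atTop (𝓝 α))
    (hk : ∀ᶠ n : ℕ in atTop, (1 + ε) * (maxDegAsymp α (meanDegree d r n) n -
      minDegAsymp α (meanDegree d r n)) < k n) : VDRecovers d r k := by
  set b := minDegAsymp α 1
  set B := HinvPlus α⁻¹
  have hb : b ≤ 1 := minDegAsymp_one_le_one α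
  have hB : 1 < B := one_lt_HinvPlus (inv_pos.2 hα)
  set g := ε * (B - b) / 4 with hg
  have hg0 : 0 < g := by
    rw [hg]
    have : 0 < B - b := by linarith
    positivity
  have hμ := tendsto_meanDegree_atTop hα hlim
  have hu : ∀ᶠ n in atTop,
      (B + g) * meanDegree d r n - (k n - 1) ≤ (b - 2 * g) * meanDegree d r n := by
    filter_upwards [hk, hμ.eventually_ge_atTop g⁻¹] with n hkn hμn
    rw [maxDegAsymp, if_neg hα.ne', minDegAsymp_eq_mul α (meanDegree d r n), ← mul_sub] at hkn
    have : 1 ≤ g * meanDegree d r n := (inv_le_iff_one_le_mul₀' hg0).1 hμn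
    have : (1 + ε) * (meanDegree d r n * (B - b)) = (B - b + 4 * g) * meanDegree d r n := by
      rw [hg]
      ring
    linarith
  refine vdRecovers_of_tendsto (fun n => (B + g) * meanDegree d r n) hplant ?_ ?_
  · obtain ⟨c, hc, hcn⟩ := exists_mul_log_le_of_tendsto_div_log
      (one_lt_mul_entropyH_of_HinvPlus_lt hα (lt_add_of_pos_right B hg0))
      ((hlim.mul_const _).congr fun n => div_mul_eq_mul_div _ _ _)
    exact tendsto_plantedLaw_highDegreeEvent hr (.of_forall fun _ => by linarith) hc hcn
  · rcases le_or_gt (b - 2 * g) 0 with ha | ha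
    · refine tendsto_const_nhds.congr' ?_
      filter_upwards [hu, hμ.eventually_ge_atTop 0] with n hun hμn
      rw [lowOuterDegreeEvent_of_nonpos (hun.trans (mul_nonpos_of_nonpos_of_nonneg ha hμn)),
        measure_empty]
    · refine tendsto_plantedLaw_lowOuterDegreeEvent_of_logarithmic hr hlim ha (by linarith)
        (one_lt_mul_entropyH_of_lt_minDegAsymp ha.le (by linarith)) (A := B + g + 1)
        (by linarith) hu ?_
      filter_upwards [hμ.eventually_ge_atTop 1] with n hμn hu0
      linarith

theorem tendsto_entropyH_mul_div_log {b : ℝ} (hb : 0 < b) :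
    Tendsto (fun L => entropyH (b * (L / Real.log L)) / L) atTop (𝓝 b) := by
  have hlog := Real.tendsto_log_atTop
  have hloglog : Tendsto (fun L => Real.log (Real.log L) / Real.log L) atTop (𝓝 0) :=
    Real.isLittleO_log_id_atTop.tendsto_div_nhds_zero.comp hlog
  have h : Tendsto (fun L : ℝ => L⁻¹ + (Real.log b - 1) * b * (Real.log L)⁻¹ + b -
      b * (Real.log (Real.log L) / Real.log L)) atTop (𝓝 b) := by
    simpa using ((tendsto_inv_atTop_zero.add (hlog.inv_tendsto_atTop.const_mul
      ((Real.log b - 1) * b))).add_const b).sub (hloglog.const_mul b)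
  refine h.congr' ?_
  filter_upwards [eventually_gt_atTop 0, hlog.eventually_gt_atTop 0] with L hL hlogL
  rw [entropyH, Real.log_mul hb.ne' (by positivity), Real.log_div hL.ne' hlogL.ne']
  field_simp
  ring

theorem tendsto_div_log_atTop : Tendsto (fun L : ℝ => L / Real.log L) atTop atTop := by
  have h : Tendsto (fun L : ℝ => Real.log L / L) atTop (𝓝[>] 0) :=
    tendsto_nhdsWithin_iff.2 ⟨Real.isLittleO_log_id_atTop.tendsto_div_nhds_zero, by
      filter_upwards [eventually_gt_atTop 1] with L hL
      exact div_pos (Real.log_pos hL) (by linarith)⟩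
  exact h.inv_tendsto_nhdsGT_zero.congr fun L => inv_div _ _

theorem tendsto_log_div_meanDegree_atTop (hr : ∀ n, 0 < r n)
    (hlim : Tendsto (fun n : ℕ => meanDegree d r n / Real.log n) atTop (𝓝 0)) :
    Tendsto (fun n : ℕ => Real.log n / meanDegree d r n) atTop atTop := by
  have h := tendsto_nhdsWithin_iff.2 ⟨hlim, (by
    filter_upwards [eventually_gt_atTop 0, tendsto_natCast_log_atTop.eventually_gt_atTop 0]
      with n hn hlog
    rw [Set.mem_Ioi, meanDegree_eq]
    have := edgeProb_pos d (hr n)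
    positivity : ∀ᶠ n : ℕ in atTop, meanDegree d r n / Real.log n ∈ Set.Ioi 0)⟩
  exact h.inv_tendsto_nhdsGT_zero.congr fun n => inv_div _ _

theorem vdRecovers_of_sublogarithmic (hr : ∀ n, 0 < r n ∧ r n < 1 / 2) (hplant : Plantable k)
    {ε : ℝ} (hε : 0 < ε)
    (hlim : Tendsto (fun n : ℕ => meanDegree d r n / Real.log n) atTop (𝓝 0))
    (hk : ∀ᶠ n : ℕ in atTop, (1 + ε) * maxDegAsymp 0 (meanDegree d r n) n ≤ k n - 1) :
    VDRecovers d r k := by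
  have hr' : ∀ n, 0 ≤ r n ∧ r n < 1 / 2 := fun n => ⟨(hr n).1.le, (hr n).2⟩
  set L : ℕ → ℝ := fun n => Real.log n / meanDegree d r n
  have hL : Tendsto L atTop atTop := tendsto_log_div_meanDegree_atTop (fun n => (hr n).1) hlim
  have hLμ : ∀ᶠ n in atTop, L n * meanDegree d r n = Real.log n := by
    filter_upwards [hL.eventually_gt_atTop 0] with n hn
    exact div_mul_cancel₀ _ fun h => hn.ne' (by simp [L, h])
  have hexponent : Tendsto (fun n : ℕ => meanDegree d r n *
      entropyH ((1 + ε) * (L n / Real.log (L n))) / Real.log n) atTop (𝓝 (1 + ε)) := by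
    refine ((tendsto_entropyH_mul_div_log (by linarith)).comp hL).congr fun n => ?_
    rw [Function.comp_apply, div_div_eq_mul_div, mul_comm]
  obtain ⟨c, hc, hcn⟩ := exists_mul_log_le_of_tendsto_div_log (lt_add_of_pos_right 1 hε) hexponent
  refine vdRecovers_of_tendsto
    (fun n => (1 + ε) * (L n / Real.log (L n)) * meanDegree d r n) hplant
    (tendsto_plantedLaw_highDegreeEvent hr' ?_ hc hcn) (tendsto_const_nhds.congr' ?_)
  · exact ((tendsto_div_log_atTop.comp hL).const_mul_atTop (by linarith)).eventually_ge_atTop 1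
  · -- The clique alone gives its vertices degree `k n - 1`, which already reaches the threshold.
    filter_upwards [hk, hLμ] with n hkn hn
    rw [lowOuterDegreeEvent_of_nonpos, measure_empty]
    rw [mul_assoc, div_mul_eq_mul_div, hn]
    rw [maxDegAsymp, if_pos rfl] at hkn
    linarith

theorem eventually_mul_le_sub_one {x y : ℕ → ℝ} {ε : ℝ} (hε : 0 < ε)
    (hy : Tendsto y atTop atTop) (h : ∀ᶠ n in atTop, (1 + ε) * x n < y n) :
    ∀ᶠ n in atTop, (1 + ε / 2) * x n ≤ y n - 1 := by
  filter_upwards [h, hy.eventually_ge_atTop ((1 + ε) / (ε / 2))] with n hn hyn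
  rw [div_le_iff₀ (half_pos hε)] at hyn
  have : (1 + ε) * ((1 + ε / 2) * x n) ≤ (1 + ε / 2) * y n := by
    linarith [mul_le_mul_of_nonneg_left hn.le (by positivity : 0 ≤ 1 + ε / 2)]
  refine le_of_mul_le_mul_left ?_ (by positivity : 0 < 1 + ε)
  linarith

theorem edgeProb_le_two_mul {ρ : ℝ} (hρ : ρ ≤ 1 / 2) (hd : d ≠ 0) {s : ℝ} (hs : 0 ≤ s)
    (hsρ : s ≤ ρ) : edgeProb d s ≤ 2 * ρ :=
  calc edgeProb d s ≤ (2 * s) ^ d := edgeProb_le_pow d hs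
    _ ≤ 2 * s := pow_le_of_le_one (by linarith) (by linarith) hd
    _ ≤ 2 * ρ := by linarith

end Regimes

end PlantedRGG

theorem theorem2_general (d : ℕ) (hd : 1 ≤ d) (ρ : ℝ) (hρ : ρ < 1 / 2) (r : ℕ → ℝ)
    (hr : ∀ n, 0 < r n ∧ r n ≤ ρ) (k : ℕ → ℕ) (hplant : PlantedRGG.Plantable k)
    (ε : ℝ) (hε : 0 < ε) :
    (∀ α : ℝ,
      Tendsto (fun n : ℕ => PlantedRGG.meanDegree d r n / Real.log n) atTop (𝓝 α) →
      (∀ᶠ n : ℕ in atTop,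
        (1 + ε) * (PlantedRGG.maxDegAsymp α (PlantedRGG.meanDegree d r n) n
          - PlantedRGG.minDegAsymp α (PlantedRGG.meanDegree d r n)) < k n) →
      (α = 0 →
        Tendsto k atTop atTop ∨
        ∀ᶠ n : ℕ in atTop,
          (1 + ε) * (PlantedRGG.maxDegAsymp α (PlantedRGG.meanDegree d r n) n
            - PlantedRGG.minDegAsymp α (PlantedRGG.meanDegree d r n)) < (k n : ℝ) - 1) →
      PlantedRGG.VDRecovers d r k) ∧
    (Tendsto (fun n : ℕ => PlantedRGG.meanDegree d r n / Real.log n) atTop atTop →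
      (∀ᶠ n : ℕ in atTop, ε * PlantedRGG.meanDegree d r n < k n) →
      PlantedRGG.VDRecovers d r k) := by
  have hr_half : ∀ n, 0 < r n ∧ r n < 1 / 2 := fun n => ⟨(hr n).1, (hr n).2.trans_lt hρ⟩
  have hr' : ∀ n, 0 ≤ r n ∧ r n < 1 / 2 := fun n => ⟨(hr n).1.le, (hr_half n).2⟩
  have hp : ∀ n, PlantedRGG.edgeProb d (r n) ≤ 2 * ρ := fun n =>
    PlantedRGG.edgeProb_le_two_mul hρ.le (by omega) (hr n).1.le (hr n).2
  refine ⟨fun α hlim hk hk0 => ?_,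
    PlantedRGG.vdRecovers_of_superlogarithmic hr' (by linarith) hp hplant hε⟩
  have hα : 0 ≤ α := ge_of_tendsto hlim <| .of_forall fun n =>
    div_nonneg (PlantedRGG.meanDegree_nonneg (fun n => (hr' n).1) n) (Real.log_natCast_nonneg n)
  rcases hα.eq_or_lt' with rfl | hα
  · specialize hk0 rfl
    simp only [PlantedRGG.minDegAsymp, zero_lt_one, if_true, sub_zero] at hk hk0
    rcases hk0 with hktop | hk1
    · exact PlantedRGG.vdRecovers_of_sublogarithmic hr_half hplant (half_pos hε) hlim
        (PlantedRGG.eventually_mul_le_sub_one hε (tendsto_natCast_atTop_atTop.comp hktop) hk)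
    · exact PlantedRGG.vdRecovers_of_sublogarithmic hr_half hplant hε hlim
        (hk1.mono fun _ h => h.le)
  · exact PlantedRGG.vdRecovers_of_logarithmic hr' hplant hε hα hlim hk

theorem theorem2 (d : ℕ) (hd : 1 ≤ d) (r : ℕ → ℝ) (hr : ∀ n, 0 < r n ∧ r n < 1 / 4)
    (k : ℕ → ℕ) (hk : ∀ n, 2 ≤ k n) (hplant : PlantedRGG.Plantable k)
    (ε : ℝ) (hε : 0 < ε) :
    (∀ α : ℝ,
      Tendsto (fun n : ℕ => PlantedRGG.meanDegree d r n / Real.log n) atTop (𝓝 α) →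
      (∀ᶠ n : ℕ in atTop,
        (1 + ε) * (PlantedRGG.maxDegAsymp α (PlantedRGG.meanDegree d r n) n
          - PlantedRGG.minDegAsymp α (PlantedRGG.meanDegree d r n)) < k n) →
      (α = 0 →
        Tendsto k atTop atTop ∨
        ∀ᶠ n : ℕ in atTop,
          (1 + ε) * (PlantedRGG.maxDegAsymp α (PlantedRGG.meanDegree d r n) n
            - PlantedRGG.minDegAsymp α (PlantedRGG.meanDegree d r n)) < (k n : ℝ) - 1) →
      PlantedRGG.VDRecovers d r k) ∧
    (Tendsto (fun n : ℕ => PlantedRGG.meanDegree d r n / Real.log n) atTop atTop →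
      (∀ᶠ n : ℕ in atTop, ε * PlantedRGG.meanDegree d r n < k n) →
      PlantedRGG.VDRecovers d r k) :=
  theorem2_general d hd (1 / 4) (by norm_num) r (fun n => ⟨(hr n).1, (hr n).2.le⟩) k hplant ε hε
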